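/- Let $\mathcal H$ be a separable complex Hilbert space. A density operator on $\mathcal H$ is a bounded operator $\rho \ge 0$ with $\operatorname{tr}(\rho)=1$. For a density operator $\rho$ let $\lambda(\rho)=(\lambda_1(\rho),\lambda_2(\rho),\dots)$ be the sequence of its nonzero eigenvalues, repeated according to multiplicity and arranged in non-increasing order, filled up with zeros if there are only finitely many. For density operators $\rho,\sigma$ write $\rho\prec\sigma$ if $$\sum_{i=1}^k\lambda_i(\rho)\le\sum_{i=1}^k\lambda_i(\sigma)\quad(k=1,2,\dots)\qquad\text{and}\qquad \sum_{i=1}^\infty\lambda_i(\rho)=\sum_{i=1}^\infty\lambda_i(\sigma).$$ A mixed unitary operation is a linear map $\Phi:\mathcal B(\mathcal H)\to\mathcal B(\mathcal H)$ of the form $\Phi(X)=\sum_{i=1}^n t_iU_iXU_i^*$ with $n<\infty$, $U_i$ unitary operators on $\mathcal H$, $t_i>0$ and $\sum_{i=1}^n t_i=1$. Proposition 3.2. Let $\rho_1,\rho_2$ be density operators on $\mathcal H$ and suppose that $\rho_1$ has finite rank. Then $\rho_1\prec\rho_2$ if and only if there exists a mixed unitary operation $\Phi$ such that $\Phi(\rho_2)=\rho_1$.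 -/

import Mathlib

namespace QuantumMajorization

section Operators

variable {H : Type*} [NormedAddCommGroup H] [InnerProductSpace ℂ H]

/-- `T` has trace `c`: in every orthonormal (Hilbert) basis of `H`, the diagonal of `T` sums
(unconditionally) to `c`. Every orthonormal basis can be indexed by its own set of vectors,
so index types that are subsets of `H` suffice. -/
def HasTrace (T : H →L[ℂ] H) (c : ℂ) : Prop :=
  ∀ (w : Set H) (b : HilbertBasis w ℂ H), HasSum (fun i => inner ℂ (b i) (T (b i))) c

/-- A density operator: a positive bounded operator of trace one. -/
def IsDensityOperator (ρ : H →L[ℂ] H) : Prop :=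
  ρ.IsPositive ∧ HasTrace ρ 1

/-- A bounded operator of finite rank: its range is finite-dimensional. -/
def IsFiniteRank (T : H →L[ℂ] H) : Prop :=
  FiniteDimensional ℂ (LinearMap.range (T : H →ₗ[ℂ] H))

/-- The cone `c₀*` of real sequences decreasing monotonically to `0`
(such sequences are automatically nonnegative). -/
def IsDecreasingToZero (a : ℕ → ℝ) : Prop :=
  Antitone a ∧ Filter.Tendsto a Filter.atTop (nhds 0)

/-- `a` is the sequence of eigenvalues of the positive operator `ρ` in non-increasing order:
it decreases to `0`, and each real `μ > 0` occurs in it exactly as often as the dimension of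
the eigenspace of `ρ` at `μ`. In particular a `μ > 0` which is not an eigenvalue does not occur,
and if `ρ` has finite rank the sequence is filled up with zeros. -/
def IsEigenvalueSequence (ρ : H →L[ℂ] H) (a : ℕ → ℝ) : Prop :=
  IsDecreasingToZero a ∧
    ∀ μ : ℝ, 0 < μ →
      {n : ℕ | a n = μ}.encard =
        Cardinal.toENat
          (Module.rank ℂ (Module.End.eigenspace (ρ : H →ₗ[ℂ] H) (μ : ℂ)))

/-- Majorization `r ≺ s` for sequences in `c₀*` (which are their own decreasing rearrangements):
partial sums of `r` are at most those of `s`, and the total sums, in `[0, ∞]`, agree. -/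
def SeqMajorizedBy (r s : ℕ → ℝ) : Prop :=
  (∀ k : ℕ, ∑ i ∈ Finset.range k, r i ≤ ∑ i ∈ Finset.range k, s i) ∧
    ∑' i, ENNReal.ofReal (r i) = ∑' i, ENNReal.ofReal (s i)

/-- Majorization `ρ ≺ σ` of density operators: `λ(ρ) ≺ λ(σ)` for their eigenvalue sequences
(a density operator has exactly one eigenvalue sequence). -/
def MajorizedBy (ρ σ : H →L[ℂ] H) : Prop :=
  ∃ a b : ℕ → ℝ, IsEigenvalueSequence ρ a ∧ IsEigenvalueSequence σ b ∧ SeqMajorizedBy a b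

/-- A mixed unitary operation: `Φ(X) = ∑ i, tᵢ Uᵢ X Uᵢ*`, a finite sum with `Uᵢ` unitary,
`tᵢ > 0` and `∑ i, tᵢ = 1`. -/
def IsMixedUnitary [CompleteSpace H] (Φ : (H →L[ℂ] H) →ₗ[ℂ] (H →L[ℂ] H)) : Prop :=
  ∃ (n : ℕ) (t : Fin n → ℝ) (U : Fin n → (H →L[ℂ] H)),
    (∀ i, 0 < t i) ∧ ∑ i, t i = 1 ∧ (∀ i, U i ∈ unitary (H →L[ℂ] H)) ∧
      ∀ X, Φ X = ∑ i, (t i : ℂ) • (U i * X * star (U i))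

end Operators

end QuantumMajorization

/-! Both directions reduce to finite dimensions. If `ρ₁ ≺ ρ₂` with `λ(ρ₁)` supported on `N` indices,
then the first `N` eigenvalues of `ρ₂` already sum to 1, so the rest vanish and both operators live
on a finite-dimensional `K`. By Rado's theorem (`mem_convexHull_range_perm`: separation,
rearrangement, Abel summation) `λ(ρ₁)` is a convex combination of permutations of `λ(ρ₂)`. A
permutation of an eigenbasis of `K`, extended by the identity on `Kᗮ`, is unitary, which gives `Φ`.

Conversely, positivity of the summands of `Φ(ρ₂)` puts the kernel of `ρ₁` inside that of each of
them, so `ρ₂` has finite rank. The sum of the top `k` eigenvalues of `ρ₁` is an average of diagonal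
sums of `ρ₂` along orthonormal `k`-tuples, each bounded by Ky Fan's inequality
(`sum_re_inner_le_of_expansion`). The totals agree because both traces are 1. -/

namespace QuantumMajorization

/-! ### Majorization of real sequences -/

/-- Abel summation: pairing with a decreasing weight is monotone for majorization. -/
theorem sum_mul_le_sum_mul_of_partial_sums_le {n : ℕ} {c a b : ℕ → ℝ}
    (hc : ∀ i, i + 1 < n → c (i + 1) ≤ c i)
    (h : ∀ k, ∑ i ∈ Finset.range k, a i ≤ ∑ i ∈ Finset.range k, b i)
    (hn : ∑ i ∈ Finset.range n, a i = ∑ i ∈ Finset.range n, b i) :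
    ∑ i ∈ Finset.range n, c i * a i ≤ ∑ i ∈ Finset.range n, c i * b i := by
  -- The induction keeps the boundary term. It vanishes at `m + 1 = n` because the totals agree, so
  -- `c` may change sign.
  have key : ∀ m, m + 1 ≤ n →
      c m * (∑ i ∈ Finset.range (m + 1), b i - ∑ i ∈ Finset.range (m + 1), a i) ≤
        ∑ i ∈ Finset.range (m + 1), c i * b i - ∑ i ∈ Finset.range (m + 1), c i * a i := by
    intro m
    induction m with
    | zero => intro _; simp [mul_sub]
    | succ m ih =>
      intro hm
      have h1 := ih (by omega)
      rw [Finset.sum_range_succ _ (m + 1), Finset.sum_range_succ _ (m + 1),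
        Finset.sum_range_succ _ (m + 1), Finset.sum_range_succ _ (m + 1)]
      have h2 := mul_le_mul_of_nonneg_right (hc m (by omega)) (sub_nonneg.2 (h (m + 1)))
      linarith
  cases n with
  | zero => simp
  | succ m =>
    have := key m le_rfl
    rw [hn, sub_self, mul_zero] at this
    linarith

/-- **Rado's theorem**: a decreasing sequence majorized by `b` is a convex combination of
rearrangements of `b`. -/
theorem mem_convexHull_range_perm {n : ℕ} {a b : ℕ → ℝ} (ha : Antitone a)
    (h : ∀ k, ∑ i ∈ Finset.range k, a i ≤ ∑ i ∈ Finset.range k, b i)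
    (hn : ∑ i ∈ Finset.range n, a i = ∑ i ∈ Finset.range n, b i) :
    (fun i : Fin n => a i) ∈
      convexHull ℝ (Set.range fun σ : Equiv.Perm (Fin n) => fun i => b (σ i)) := by
  by_contra hmem
  have hcpt : IsClosed (convexHull ℝ
      (Set.range fun σ : Equiv.Perm (Fin n) => fun i => b (σ i))) :=
    (Set.finite_range _).isClosed_convexHull ℝ
  -- The separating functional, once its coefficients are sorted decreasingly, is no larger at `a`
  -- than at one rearrangement of `b`, a contradiction.
  obtain ⟨f, u, hf, hu⟩ := geometric_hahn_banach_closed_point (convex_convexHull ℝ _) hcpt hmem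
  set c : Fin n → ℝ := fun i => f (Pi.single i 1) with hcdef
  have hfc : ∀ x : Fin n → ℝ, f x = ∑ i, c i * x i := by
    intro x
    conv_lhs => rw [← Finset.univ_sum_single x]
    rw [map_sum]
    refine Finset.sum_congr rfl fun i _ => ?_
    have : Pi.single i (x i) = x i • (Pi.single i 1 : Fin n → ℝ) := by
      rw [← Pi.single_smul]; simp
    rw [this, map_smul, smul_eq_mul, mul_comm]
  set τ : Equiv.Perm (Fin n) := Tuple.sort (fun i => - c i) with hτ
  have hanti : Antitone (c ∘ τ) := fun i j hij => by
    have := Tuple.monotone_sort (fun i => - c i) hij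
    simpa using this
  have h1 : ∑ i, c i * a i ≤ ∑ i, c (τ i) * a i := by
    have hmono : Monovary (c ∘ τ) (fun i : Fin n => a i) :=
      hanti.monovary (fun i j hij => ha hij)
    have := hmono.sum_comp_perm_mul_le_sum_mul (σ := τ⁻¹)
    simpa using this
  have h2 : ∑ i, c (τ i) * a i ≤ ∑ i, c (τ i) * b i := by
    set c' : ℕ → ℝ := fun i => if hi : i < n then c (τ ⟨i, hi⟩) else 0 with hc'
    have hcc : ∀ i : Fin n, c (τ i) = c' i := fun i => by simp [hc']
    simp only [hcc]
    rw [Fin.sum_univ_eq_sum_range (fun i => c' i * a i),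
      Fin.sum_univ_eq_sum_range (fun i => c' i * b i)]
    refine sum_mul_le_sum_mul_of_partial_sums_le (fun i hi => ?_) h hn
    simp only [hc', hi, (Nat.lt_succ_self i).trans hi, dif_pos]
    exact hanti (by simp [Fin.le_def])
  have h3 : ∑ i, c (τ i) * b i = ∑ i, c i * b (τ⁻¹ i) := by
    rw [← Equiv.sum_comp τ (fun i => c i * b (τ⁻¹ i : Fin n))]
    simp
  have h4 := hf _ (subset_convexHull ℝ _ ⟨τ⁻¹, rfl⟩)
  rw [hfc] at h4 hu
  linarith

/-- Weights in `[0, 1]` of total mass at most `k` give a decreasing sequence a weighted sum of at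
most its first `k` terms. -/
theorem sum_mul_le_sum_range_of_weights {n k : ℕ} {b : ℕ → ℝ} {w : Fin n → ℝ}
    (hb : Antitone b) (hb0 : ∀ i, 0 ≤ b i) (hw0 : ∀ i, 0 ≤ w i) (hw1 : ∀ i, w i ≤ 1)
    (hwk : ∑ i, w i ≤ k) :
    ∑ i : Fin n, b i * w i ≤ ∑ i ∈ Finset.range k, b i := by
  -- Subtracting `b k` leaves nonnegative terms exactly where weight 1 is optimal; the shift costs
  -- at most `k * b k`.
  have h1 : ∀ i : Fin n, (b i - b k) * w i ≤ if (i : ℕ) < k then b i - b k else 0 := by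
    intro i
    split_ifs with hi
    · exact mul_le_of_le_one_right (sub_nonneg.2 (hb hi.le)) (hw1 i)
    · exact mul_nonpos_of_nonpos_of_nonneg (sub_nonpos.2 (hb (not_lt.1 hi))) (hw0 i)
  have h2 : ∑ i : Fin n, (if (i : ℕ) < k then b i - b k else 0) ≤
      ∑ i ∈ Finset.range k, (b i - b k) := by
    rw [Fin.sum_univ_eq_sum_range (fun i => if i < k then b i - b k else 0),
      ← Finset.sum_filter]
    refine Finset.sum_le_sum_of_subset_of_nonneg (fun i hi => ?_) fun i hi _ => ?_
    · simpa using (Finset.mem_filter.1 hi).2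
    · exact sub_nonneg.2 (hb (Finset.mem_range.1 hi).le)
  have h3 := Finset.sum_le_sum fun i (_ : i ∈ Finset.univ) => h1 i
  have h4 : ∑ i : Fin n, b i * w i = ∑ i : Fin n, (b i - b k) * w i + b k * ∑ i, w i := by
    rw [Finset.mul_sum, ← Finset.sum_add_distrib]
    exact Finset.sum_congr rfl fun i _ => by ring
  have h5 := mul_le_mul_of_nonneg_left hwk (hb0 k)
  rw [Finset.sum_sub_distrib, Finset.sum_const, Finset.card_range, nsmul_eq_mul] at h2
  linarith

/-! ### Eigenvalue sequences and eigenvector expansions -/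

section Spectral

variable {H : Type*} [NormedAddCommGroup H] [InnerProductSpace ℂ H]

/-- The quadratic form at `x + t T x` is nonnegative for all real `t` and has no constant term, so
its linear coefficient `2‖T x‖²` must vanish. -/
theorem apply_eq_zero_of_re_inner_eq_zero {T : H →L[ℂ] H} (hT : T.IsPositive) {x : H}
    (hx : (inner ℂ x (T x)).re = 0) : T x = 0 := by
  have hq : ∀ t : ℝ, 0 ≤ (inner ℂ (T x) (T (T x))).re * (t * t) + 2 * ‖T x‖ ^ 2 * t + 0 := by
    intro t
    have h := hT.re_inner_nonneg_right (x + (t : ℂ) • T x)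
    have h1 : inner ℂ x (T (T x)) = inner ℂ (T x) (T x) := (hT.isSymmetric x (T x)).symm
    have h2 : (inner ℂ (T x) (T x)).re = ‖T x‖ ^ 2 := by
      rw [inner_self_eq_norm_sq_to_K]; norm_cast
    simp only [map_add, map_smul, inner_add_left, inner_add_right, inner_smul_left,
      inner_smul_right, h1, Complex.conj_ofReal, RCLike.re_to_complex, Complex.add_re,
      Complex.re_ofReal_mul, hx, h2] at h
    linarith
  have h := discrim_le_zero hq
  have h0 : ‖T x‖ ^ 2 = 0 := by
    simp only [discrim] at h
    nlinarith [sq_nonneg (‖T x‖ ^ 2)]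
  simpa using h0

/-- A positive operator of finite rank has an orthonormal eigenvector expansion. -/
theorem exists_expansion_of_isFiniteRank {T : H →L[ℂ] H} (hT : T.IsPositive)
    (hfin : IsFiniteRank T) :
    ∃ (n : ℕ) (c : ℕ → ℝ) (e : Fin n → H), Antitone c ∧ (∀ i, 0 ≤ c i) ∧ (∀ i, n ≤ i → c i = 0) ∧
      Orthonormal ℂ e ∧ ∀ x, T x = ∑ i : Fin n, ((c i : ℂ) * inner ℂ (e i) x) • e i := by
  set R := LinearMap.range (T : H →ₗ[ℂ] H) with hR
  have : FiniteDimensional ℂ R := hfin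
  have hinv : ∀ x ∈ R, (T : H →ₗ[ℂ] H) x ∈ R := fun x _ => ⟨x, rfl⟩
  have hpos : ((T : H →ₗ[ℂ] H).restrict hinv).IsPositive :=
    ⟨fun x y => hT.isSymmetric x y, fun x => hT.re_inner_nonneg_left (x : H)⟩
  have hs := hpos.isSymmetric
  set v := hs.eigenvectorBasis rfl with hv
  set l := hs.eigenvalues rfl with hl
  have hl0 : ∀ i, 0 ≤ l i := hpos.nonneg_eigenvalues rfl
  have hla : Antitone l := hs.eigenvalues_antitone rfl
  have hTv : ∀ i, T (v i) = (l i : ℂ) • (v i : H) := fun i =>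
    congrArg (Subtype.val) (hs.apply_eigenvectorBasis rfl i)
  refine ⟨Module.finrank ℂ R, fun i => if h : i < Module.finrank ℂ R then l ⟨i, h⟩ else 0,
    fun i => v i, ?_, ?_, ?_, ?_, ?_⟩
  · intro i j hij
    by_cases hj : j < Module.finrank ℂ R
    · simpa [hj, hij.trans_lt hj] using hla (Fin.mk_le_mk.2 hij)
    · simp only [hj, dif_neg, not_false_eq_true]
      split_ifs
      · exact hl0 _
      · exact le_rfl
  · intro i
    dsimp only
    split_ifs
    · exact hl0 _
    · exact le_rfl
  · intro i hi
    simp [not_lt.2 hi]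
  · exact v.orthonormal.comp_linearIsometry R.subtypeₗᵢ
  · intro x
    -- Expand `T x`, not `x`, since only `T x` lies in `R`; symmetry then moves `T` onto the
    -- eigenvectors.
    have h := congrArg Subtype.val (v.sum_repr' ⟨T x, x, rfl⟩)
    simp only [Submodule.coe_sum, Submodule.coe_smul, Submodule.coe_inner] at h
    rw [← h]
    refine Finset.sum_congr rfl fun i _ => ?_
    congr 1
    rw [← hT.inner_left_eq_inner_right, hTv, inner_smul_left]
    simp

theorem apply_eq_smul_of_expansion {T : H →L[ℂ] H} {n : ℕ} {c : ℕ → ℝ} {e : Fin n → H}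
    (he : Orthonormal ℂ e)
    (hexp : ∀ x, T x = ∑ i : Fin n, ((c i : ℂ) * inner ℂ (e i) x) • e i) (i : Fin n) :
    T (e i) = (c i : ℂ) • e i := by
  rw [hexp, Finset.sum_eq_single i]
  · simp [he.1 i]
  · intro j _ hj
    rw [he.2 hj]; simp
  · simp

/-- The coefficients of an orthonormal eigenvector expansion form the eigenvalue sequence. -/
theorem isEigenvalueSequence_of_expansion {T : H →L[ℂ] H} {n : ℕ} {c : ℕ → ℝ} {e : Fin n → H}
    (hc : Antitone c) (hcn : ∀ i, n ≤ i → c i = 0) (he : Orthonormal ℂ e)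
    (hexp : ∀ x, T x = ∑ i : Fin n, ((c i : ℂ) * inner ℂ (e i) x) • e i) :
    IsEigenvalueSequence T c := by
  refine ⟨⟨hc, ?_⟩, fun μ hμ => ?_⟩
  · refine tendsto_const_nhds.congr' ?_
    filter_upwards [Filter.eventually_ge_atTop n] with i hi
    exact (hcn i hi).symm
  have hspan : Module.End.eigenspace (T : H →ₗ[ℂ] H) (μ : ℂ) =
      Submodule.span ℂ (e '' {i | c i = μ}) := by
    apply le_antisymm
    · intro x hx
      rw [Module.End.mem_eigenspace_iff] at hx
      have hx' : T x = (μ : ℂ) • x := hx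
      have hμ0 : (μ : ℂ) ≠ 0 := by exact_mod_cast hμ.ne'
      have hx2 : x = (μ : ℂ)⁻¹ • ∑ i : Fin n, ((c i : ℂ) * inner ℂ (e i) x) • e i := by
        rw [← hexp, hx', smul_smul, inv_mul_cancel₀ hμ0, one_smul]
      rw [hx2]
      refine Submodule.smul_mem _ _ (Submodule.sum_mem _ fun i _ => ?_)
      by_cases hi : c i = μ
      · exact Submodule.smul_mem _ _ (Submodule.subset_span ⟨i, hi, rfl⟩)
      · have h1 : inner ℂ (e i) (T x) = (c i : ℂ) * inner ℂ (e i) x := by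
          rw [hexp, he.inner_right_fintype]
        rw [hx', inner_smul_right] at h1
        have h2 : inner ℂ (e i) x = 0 := by
          have h3 : ((μ : ℂ) - c i) * inner ℂ (e i) x = 0 := by rw [sub_mul, h1, sub_self]
          rcases mul_eq_zero.1 h3 with h | h
          · exact absurd (by exact_mod_cast (sub_eq_zero.1 h).symm) hi
          · exact h
        simp [h2]
    · rw [Submodule.span_le]
      rintro _ ⟨i, hi, rfl⟩
      have hi' : c i = μ := hi
      rw [SetLike.mem_coe, Module.End.mem_eigenspace_iff, ← hi']
      exact apply_eq_smul_of_expansion he hexp i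
  rw [hspan, toENat_rank_span_set (he.linearIndependent.linearIndepOn _)]
  have himg : {m : ℕ | c m = μ} = Fin.val '' {i : Fin n | c i = μ} := by
    ext m
    constructor
    · intro hm
      have hm' : c m = μ := hm
      have hmn : m < n := by
        by_contra h
        rw [hcn m (not_lt.1 h)] at hm'
        exact hμ.ne hm'
      exact ⟨⟨m, hmn⟩, hm, rfl⟩
    · rintro ⟨i, hi, rfl⟩
      exact hi
  rw [himg, Fin.val_injective.encard_image]

/-- Each positive level of an eigenvalue sequence carries an orthonormal basis of the
eigenspace. -/
theorem IsEigenvalueSequence.exists_eigenspace_basis {T : H →L[ℂ] H} {a : ℕ → ℝ}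
    (ha : IsEigenvalueSequence T a) {μ : ℝ} (hμ : 0 < μ) :
    ∃ g : ℕ → H, Orthonormal ℂ (fun n : {n // a n = μ} => g n) ∧
      (∀ n, a n = μ → T (g n) = (μ : ℂ) • g n) ∧
      ∀ x, T x = (μ : ℂ) • x → x ∈ Submodule.span ℂ (g '' {n | a n = μ}) := by
  set V := Module.End.eigenspace (T : H →ₗ[ℂ] H) (μ : ℂ) with hV
  -- Since `a` tends to 0, its positive levels are finite; this makes the eigenspace
  -- finite-dimensional.
  have hfin : {n | a n = μ}.Finite := by
    obtain ⟨N, hN⟩ := Filter.eventually_atTop.1 (ha.1.2.eventually (gt_mem_nhds hμ))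
    refine (Set.finite_lt_nat N).subset fun n hn => ?_
    by_contra h
    exact (hN n (not_lt.1 h)).ne hn
  have hcard := ha.2 μ hμ
  have : Fintype {n // a n = μ} := hfin.fintype
  have hfd : FiniteDimensional ℂ V := by
    rw [FiniteDimensional, ← Module.rank_lt_aleph0_iff, ← Cardinal.toENat_lt_top, ← hcard]
    exact hfin.encard_lt_top
  have hrank : Module.finrank ℂ V = Fintype.card {n // a n = μ} := by
    rw [← Module.finrank_eq_rank, Cardinal.toENat_nat, ← hfin.cast_ncard_eq] at hcard
    rw [← Nat.card_eq_fintype_card]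
    exact_mod_cast hcard.symm
  let b : OrthonormalBasis {n // a n = μ} ℂ V :=
    (stdOrthonormalBasis ℂ V).reindex
      (Fintype.equivOfCardEq (by rw [Fintype.card_fin, hrank]))
  classical
  let g : ℕ → H := fun n => if h : a n = μ then b ⟨n, h⟩ else 0
  have hg : ∀ n : {n // a n = μ}, g n = b n := fun n => by simp [g, n.2]
  refine ⟨g, ?_, ?_, ?_⟩
  · simp only [hg]
    exact b.orthonormal.comp_linearIsometry V.subtypeₗᵢ
  · intro n hn
    rw [hg ⟨n, hn⟩]
    exact Module.End.mem_eigenspace_iff.1 (b ⟨n, hn⟩).2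
  · intro x hx
    have hxV : x ∈ V := Module.End.mem_eigenspace_iff.2 hx
    have h := congrArg Subtype.val (b.sum_repr ⟨x, hxV⟩)
    simp only [Submodule.coe_sum, Submodule.coe_smul] at h
    rw [← h]
    refine Submodule.sum_mem _ fun i _ => Submodule.smul_mem _ _ ?_
    exact Submodule.subset_span ⟨i, i.2, hg i⟩

/-- An eigenvalue sequence of a symmetric operator is realised by orthonormal eigenvectors
spanning all eigenspaces at positive eigenvalues. -/
theorem IsEigenvalueSequence.exists_orthonormal {T : H →L[ℂ] H} (hT : T.IsPositive) {a : ℕ → ℝ}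
    (ha : IsEigenvalueSequence T a) :
    ∃ e : ℕ → H, Orthonormal ℂ (fun n : {n // 0 < a n} => e n) ∧
      (∀ n, 0 < a n → T (e n) = (a n : ℂ) • e n) ∧
      ∀ (μ : ℝ) x, 0 < μ → T x = (μ : ℂ) • x → x ∈ Submodule.span ℂ (e '' {n | 0 < a n}) := by
  choose! g hg1 hg2 hg3 using fun (μ : ℝ) (hμ : 0 < μ) => ha.exists_eigenspace_basis hμ
  -- Glue the bases of the levels; distinct levels are orthogonal by symmetry of `T`.
  refine ⟨fun n => g (a n) n, ⟨fun n => ?_, fun m n hmn => ?_⟩, ?_, ?_⟩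
  · exact (hg1 (a n) n.2).1 ⟨n, rfl⟩
  · dsimp only
    by_cases h : a m = a n
    · rw [h]
      exact (hg1 (a n) n.2).2 (i := ⟨m, h⟩) (j := ⟨n, rfl⟩)
        (fun h2 => hmn (Subtype.ext (by simpa using h2)))
    · have h1 := hT.inner_left_eq_inner_right (g (a m) m) (g (a n) n)
      rw [hg2 _ m.2 _ rfl, hg2 _ n.2 _ rfl, inner_smul_left, inner_smul_right,
        Complex.conj_ofReal] at h1
      have h3 : ((a m : ℂ) - a n) * inner ℂ (g (a m) m) (g (a n) n) = 0 := by
        rw [sub_mul, h1, sub_self]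
      rcases mul_eq_zero.1 h3 with h' | h'
      · exact absurd (by exact_mod_cast sub_eq_zero.1 h') h
      · exact h'
  · intro n hn
    exact hg2 _ hn _ rfl
  · intro μ x hμ hx
    refine Submodule.span_mono ?_ (hg3 μ hμ x hx)
    rintro _ ⟨n, hn, rfl⟩
    have hn' : a n = μ := hn
    refine ⟨n, ?_, ?_⟩
    · simpa [hn'] using hμ
    · simp [hn']

/-- If `S` spans all eigenspaces of a positive finite-rank operator at positive eigenvalues, then
the operator vanishes on the orthogonal complement of `S`. -/
theorem apply_eq_zero_of_forall_inner_eq_zero {T : H →L[ℂ] H} (hT : T.IsPositive)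
    (hfin : IsFiniteRank T) {S : Set H}
    (hspan : ∀ (μ : ℝ) x, 0 < μ → T x = (μ : ℂ) • x → x ∈ Submodule.span ℂ S) {x : H}
    (hx : ∀ y ∈ S, inner ℂ y x = 0) : T x = 0 := by
  obtain ⟨n, c, f, -, hc0, -, hf, hexp⟩ := exists_expansion_of_isFiniteRank hT hfin
  have hxS : ∀ y ∈ Submodule.span ℂ S, inner ℂ y x = 0 := by
    intro y hy
    induction hy using Submodule.span_induction with
    | mem y hy => exact hx y hy
    | zero => simp
    | add y z _ _ hy hz => rw [inner_add_left, hy, hz, add_zero]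
    | smul r y _ hy => rw [inner_smul_left, hy, mul_zero]
  rw [hexp]
  refine Finset.sum_eq_zero fun i _ => ?_
  rcases (hc0 i).eq_or_lt with h | h
  · simp [← h]
  · have hTf : T (f i) = (c i : ℂ) • f i := by
      rw [hexp, Finset.sum_eq_single i]
      · simp [hf.1 i]
      · intro j _ hj
        rw [hf.2 hj]; simp
      · simp
    rw [hxS _ (hspan _ _ h hTf)]
    simp

end Spectral

/-! ### Trace, Ky Fan's inequality and diagonalization on a subspace -/

section Trace

variable {H : Type*} [NormedAddCommGroup H] [InnerProductSpace ℂ H]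

/-- Extend an orthonormal family of eigenvectors to a Hilbert basis in which the trace is
computed. -/
theorem HasTrace.exists_diagonal [CompleteSpace H] {T : H →L[ℂ] H} {c : ℝ} (hc : HasTrace T c)
    {ι : Type*} {a : ι → ℝ} {e : ι → H} (he : Orthonormal ℂ e)
    (hTe : ∀ i, T (e i) = (a i : ℂ) • e i) :
    ∃ (w : Set H) (b : HilbertBasis w ℂ H) (j : ι → w), Function.Injective j ∧
      (∀ i, b (j i) = e i) ∧ HasSum (fun x => (inner ℂ (b x) (T (b x))).re) c ∧
      ∀ i, (inner ℂ (b (j i)) (T (b (j i)))).re = a i := by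
  obtain ⟨w, b, hw, hb⟩ := he.toSubtypeRange.exists_hilbertBasis_extension
  refine ⟨w, b, fun i => ⟨e i, hw ⟨i, rfl⟩⟩, fun i k h => ?_, fun i => by rw [hb], ?_, fun i => ?_⟩
  · exact he.linearIndependent.injective (congrArg Subtype.val h)
  · simpa using Complex.hasSum_re (hc w b)
  · rw [hb]
    simp [hTe, he.1 i]

/-- If eigenvectors exhaust an operator, the eigenvalues sum to the trace. -/
theorem HasTrace.hasSum_eigenvalues [CompleteSpace H] {T : H →L[ℂ] H} {c : ℝ} (hc : HasTrace T c)
    {ι : Type*} {a : ι → ℝ} {e : ι → H} (he : Orthonormal ℂ e)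
    (hTe : ∀ i, T (e i) = (a i : ℂ) • e i)
    (hker : ∀ x, (∀ i, inner ℂ (e i) x = 0) → T x = 0) : HasSum a c := by
  obtain ⟨w, b, j, hj, hbj, hsum, hdiag⟩ := hc.exists_diagonal he hTe
  rw [← hj.hasSum_iff] at hsum
  · exact hsum.congr_fun fun i => (hdiag i).symm
  · intro x hx
    rw [hker (b x) fun i => ?_]
    · simp
    · rw [← hbj i]
      exact b.orthonormal.2 fun h => hx ⟨i, h⟩

/-- If eigenvalues of a positive operator already sum to the trace, then the operator vanishes on
the orthogonal complement of the eigenvectors. -/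
theorem HasTrace.apply_eq_zero_of_hasSum [CompleteSpace H] {T : H →L[ℂ] H} (hT : T.IsPositive)
    {c : ℝ} (hc : HasTrace T c) {ι : Type*} {a : ι → ℝ} {e : ι → H} (he : Orthonormal ℂ e)
    (hTe : ∀ i, T (e i) = (a i : ℂ) • e i) (ha : HasSum a c) {x : H}
    (hx : ∀ i, inner ℂ (e i) x = 0) : T x = 0 := by
  classical
  obtain ⟨w, b, j, hj, hbj, hsum, hdiag⟩ := hc.exists_diagonal he hTe
  set f : w → ℝ := fun x => (inner ℂ (b x) (T (b x))).re with hf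
  have hf0 : ∀ y, 0 ≤ f y := fun y => hT.re_inner_nonneg_right (b y)
  -- The diagonal entries at the eigenvectors exhaust the trace, so the remaining nonnegative
  -- entries are all zero.
  set g : w → ℝ := fun y => if y ∈ Set.range j then f y else 0 with hg
  have hgs : HasSum g c := by
    rw [← hj.hasSum_iff]
    · refine ha.congr_fun fun i => ?_
      simp [hg, hf, hdiag]
    · intro y hy
      simp only [hg, if_neg hy]
  have h0 : HasSum (fun y => f y - g y) 0 := by simpa using hsum.sub hgs
  have hnn : ∀ y, 0 ≤ f y - g y := by
    intro y
    simp only [hg]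
    split_ifs
    · simp
    · simpa using hf0 y
  have hfg := (hasSum_zero_iff_of_nonneg hnn).1 h0
  have hzero : ∀ y ∉ Set.range j, T (b y) = 0 := by
    intro y hy
    apply apply_eq_zero_of_re_inner_eq_zero hT
    have := congrFun hfg y
    simpa only [hg, if_neg hy, sub_zero, Pi.zero_apply] using this
  have hTx := (b.hasSum_repr x).mapL T
  have hterm : (fun y => T (b.repr x y • b y)) = fun _ => 0 := by
    funext y
    rw [map_smul, b.repr_apply_apply]
    by_cases hy : y ∈ Set.range j
    · obtain ⟨i, rfl⟩ := hy
      rw [hbj, hx, zero_smul]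
    · rw [hzero y hy, smul_zero]
  rw [hterm] at hTx
  exact hTx.unique hasSum_zero

theorem re_inner_expansion {T : H →L[ℂ] H} {n : ℕ} {c : ℕ → ℝ} {e : Fin n → H}
    (hexp : ∀ x, T x = ∑ i : Fin n, ((c i : ℂ) * inner ℂ (e i) x) • e i) (x : H) :
    (inner ℂ x (T x)).re = ∑ i : Fin n, c i * ‖inner ℂ (e i) x‖ ^ 2 := by
  rw [hexp, inner_sum, Complex.re_sum]
  refine Finset.sum_congr rfl fun i _ => ?_
  rw [inner_smul_right, mul_assoc, Complex.re_ofReal_mul, ← inner_conj_symm x (e i),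
    Complex.mul_conj, Complex.ofReal_re, Complex.normSq_eq_norm_sq]

/-- **Ky Fan's inequality**: the diagonal of `T` along `k` orthonormal vectors sums to at most the
sum of the `k` largest eigenvalues. -/
theorem sum_re_inner_le_of_expansion {T : H →L[ℂ] H} {n k : ℕ} {c : ℕ → ℝ} {e : Fin n → H}
    (hc : Antitone c) (hc0 : ∀ i, 0 ≤ c i) (he : Orthonormal ℂ e)
    (hexp : ∀ x, T x = ∑ i : Fin n, ((c i : ℂ) * inner ℂ (e i) x) • e i)
    {g : Fin k → H} (hg : Orthonormal ℂ g) :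
    ∑ i, (inner ℂ (g i) (T (g i))).re ≤ ∑ i ∈ Finset.range k, c i := by
  simp only [re_inner_expansion hexp]
  rw [Finset.sum_comm]
  simp only [← Finset.mul_sum]
  -- Bessel for `g` bounds each weight by 1; Bessel for `e` bounds their total by `k`.
  refine sum_mul_le_sum_range_of_weights hc hc0 (fun i => by positivity) (fun i => ?_) ?_
  · have := hg.sum_inner_products_le (e i) (s := Finset.univ)
    simp only [he.1 i, one_pow] at this
    simpa only [norm_inner_symm] using this
  · rw [Finset.sum_comm]
    calc ∑ y, ∑ x, ‖inner ℂ (e x) (g y)‖ ^ 2 ≤ ∑ y : Fin k, (1 : ℝ) :=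
          Finset.sum_le_sum fun y _ => by
            have := he.sum_inner_products_le (g y) (s := Finset.univ)
            simpa only [hg.1 y, one_pow] using this
      _ = k := by simp

/-- In a finite-dimensional subspace containing its eigenvectors, an operator given by an
eigenvalue sequence is diagonal. -/
theorem exists_orthonormalBasis_expansion {T : H →L[ℂ] H} {a : ℕ → ℝ} (ha : Antitone a)
    (ha0 : ∀ i, 0 ≤ a i) {e : ℕ → H} (he : Orthonormal ℂ (fun n : {n // 0 < a n} => e n))
    (hTe : ∀ n, 0 < a n → T (e n) = (a n : ℂ) • e n)
    (hker : ∀ x, (∀ n : {n // 0 < a n}, inner ℂ (e n) x = 0) → T x = 0)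
    (K : Submodule ℂ H) [FiniteDimensional ℂ K] (heK : ∀ n, 0 < a n → e n ∈ K) :
    (∀ n, Module.finrank ℂ K ≤ n → a n = 0) ∧
    ∃ f : OrthonormalBasis (Fin (Module.finrank ℂ K)) ℂ K,
      ∀ x, T x = ∑ i : Fin (Module.finrank ℂ K), ((a i : ℂ) * inner ℂ (f i : H) x) • (f i : H) := by
  have hlt : ∀ n, 0 < a n → n < Module.finrank ℂ K := by
    intro n hn
    have hpos : ∀ i : Fin (n + 1), 0 < a i := fun i => hn.trans_le (ha (Nat.lt_succ_iff.1 i.2))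
    have ho : Orthonormal ℂ (fun i : Fin (n + 1) => (⟨e i, heK i (hpos i)⟩ : K)) := by
      have := he.comp (fun i : Fin (n + 1) => (⟨i, hpos i⟩ : {n // 0 < a n}))
        (fun i k h => Fin.ext (congrArg Subtype.val h))
      exact ⟨this.1, this.2⟩
    have := ho.linearIndependent.fintype_card_le_finrank
    rw [Fintype.card_fin] at this
    omega
  have hzero : ∀ n, Module.finrank ℂ K ≤ n → a n = 0 := fun n hn =>
    le_antisymm (not_lt.1 fun h => absurd (hlt n h) (not_lt.2 hn)) (ha0 n)
  refine ⟨hzero, ?_⟩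
  classical
  let v : Fin (Module.finrank ℂ K) → K := fun i =>
    if h : 0 < a i then ⟨e i, heK i h⟩ else 0
  let s : Set (Fin (Module.finrank ℂ K)) := {i | 0 < a i}
  have hv : ∀ i ∈ s, (v i : H) = e i := fun i hi => by
    have hi' : 0 < a i := hi
    simp [v, hi']
  have ho : Orthonormal ℂ (s.domRestrict v) := by
    have := he.comp (fun i : s => (⟨i.1, i.2⟩ : {n // 0 < a n}))
      (fun i k h => Subtype.ext (Fin.ext (congrArg Subtype.val h)))
    have h2 : Orthonormal ℂ (fun i : s => (v i : H)) := by
      convert this using 2 with i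
      exact hv i i.2
    exact ⟨h2.1, h2.2⟩
  obtain ⟨f, hf⟩ := ho.exists_orthonormalBasis_extension_of_card_eq (by simp)
  have hfe : ∀ i : Fin (Module.finrank ℂ K), 0 < a i → (f i : H) = e i := fun i hi => by
    rw [hf i hi, hv i hi]
  have hfo : Orthonormal ℂ (fun i => (f i : H)) := f.orthonormal.comp_linearIsometry K.subtypeₗᵢ
  have hTf : ∀ i, T (f i) = (a i : ℂ) • (f i : H) := by
    intro i
    by_cases hi : 0 < a i
    · rw [hfe i hi, hTe _ hi]
    · rw [le_antisymm (not_lt.1 hi) (ha0 i), Complex.ofReal_zero, zero_smul]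
      refine hker _ fun n => ?_
      rw [← hfe ⟨n, hlt n n.2⟩ n.2]
      refine hfo.2 fun h => hi ?_
      rw [← h]
      exact n.2
  refine ⟨f, fun x => ?_⟩
  set y := x - ∑ i, inner ℂ (f i : H) x • (f i : H) with hy
  have hTy : T y = 0 := by
    refine hker _ fun n => ?_
    rw [← hfe ⟨n, hlt n n.2⟩ n.2, hy, inner_sub_right, hfo.inner_right_fintype, sub_self]
  have hx : x = y + ∑ i, inner ℂ (f i : H) x • (f i : H) := by rw [hy, sub_add_cancel]
  conv_lhs => rw [hx]
  rw [map_add, hTy, zero_add, map_sum]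
  refine Finset.sum_congr rfl fun i _ => ?_
  rw [map_smul, hTf, smul_smul, mul_comm]

end Trace

/-! ### Unitaries extending a change of basis -/

section Unitary

variable {H : Type*} [NormedAddCommGroup H] [InnerProductSpace ℂ H] [CompleteSpace H]

/-- Two orthonormal bases of a finite-dimensional subspace are related by a unitary operator of
the whole space. -/
theorem exists_unitary_apply_eq {K : Submodule ℂ H} [FiniteDimensional ℂ K] {ι : Type*} [Fintype ι]
    (f f' : OrthonormalBasis ι ℂ K) :
    ∃ U ∈ unitary (H →L[ℂ] H), ∀ i, U (f' i) = f i := by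
  let W : K ≃ₗᵢ[ℂ] K := f'.equiv f (Equiv.refl ι)
  let V : H ≃ₗᵢ[ℂ] H := (K.orthogonalDecomposition.trans
    (LinearIsometryEquiv.withLpProdCongr 2 W (LinearIsometryEquiv.refl ℂ Kᗮ))).trans
      K.orthogonalDecomposition.symm
  refine ⟨_, (Unitary.linearIsometryEquiv.symm V).2, fun i => ?_⟩
  rw [Unitary.coe_symm_linearIsometryEquiv_apply]
  change V (f' i) = f i
  simp [V, W, Submodule.orthogonalDecomposition_symm_apply]

theorem inner_star_apply_of_unitary (U : H →L[ℂ] H) (x y : H) :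
    inner ℂ x (star U y) = inner ℂ (U x) y := by
  rw [ContinuousLinearMap.star_eq_adjoint, ContinuousLinearMap.adjoint_inner_right]

end Unitary

/-! ### The two implications -/

section MixedUnitary

variable {H : Type*} [NormedAddCommGroup H] [InnerProductSpace ℂ H] [CompleteSpace H]

theorem IsDecreasingToZero.nonneg {a : ℕ → ℝ} (ha : IsDecreasingToZero a) (n : ℕ) : 0 ≤ a n :=
  ha.1.le_of_tendsto ha.2 n

theorem re_inner_mixedUnitary {n : ℕ} (t : Fin n → ℝ) (U : Fin n → (H →L[ℂ] H)) (X : H →L[ℂ] H)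
    (x : H) :
    (inner ℂ x ((∑ i, (t i : ℂ) • (U i * X * star (U i))) x)).re =
      ∑ i, t i * (inner ℂ (star (U i) x) (X (star (U i) x))).re := by
  rw [sum_apply, inner_sum, Complex.re_sum]
  refine Finset.sum_congr rfl fun i _ => ?_
  rw [smul_apply, inner_smul_right, Complex.re_ofReal_mul,
    ← inner_star_apply_of_unitary (star (U i)), star_star]
  rfl

/-- If a mixed unitary operation sends a positive operator to one of finite rank, then that
operator has finite rank. -/
theorem isFiniteRank_of_mixedUnitary {n : ℕ} {t : Fin n → ℝ} {U : Fin n → (H →L[ℂ] H)}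
    {X Y : H →L[ℂ] H} (hX : X.IsPositive) (ht : ∀ i, 0 < t i)
    (hU : ∀ i, U i ∈ unitary (H →L[ℂ] H)) (hY : Y = ∑ i, (t i : ℂ) • (U i * X * star (U i)))
    (hfin : IsFiniteRank Y) (i : Fin n) : IsFiniteRank X := by
  have hker : ∀ x, Y x = 0 → X (star (U i) x) = 0 := by
    intro x hx
    have h := re_inner_mixedUnitary t U X x
    rw [← hY, hx, inner_zero_right, Complex.zero_re] at h
    have h0 := (Finset.sum_eq_zero_iff_of_nonneg fun k _ =>
      mul_nonneg (ht k).le (hX.re_inner_nonneg_right (star (U k) x))).1 h.symm i (Finset.mem_univ i)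
    exact apply_eq_zero_of_re_inner_eq_zero hX ((mul_eq_zero.1 h0).resolve_left (ht i).ne')
  have hle : LinearMap.ker (Y : H →ₗ[ℂ] H) ≤
      LinearMap.ker ((X * star (U i) : H →L[ℂ] H) : H →ₗ[ℂ] H) :=
    fun x hx => hker x hx
  -- `X * star (U i)` factors through the quotient by `ker Y`, which is isomorphic to the range of
  -- `Y`; `star (U i)` is onto, so no range is lost.
  have hrange : LinearMap.range (X : H →ₗ[ℂ] H) ≤
      LinearMap.range ((LinearMap.ker (Y : H →ₗ[ℂ] H)).liftQ _ hle) := by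
    rintro _ ⟨x, rfl⟩
    refine ⟨Submodule.Quotient.mk (U i x), ?_⟩
    have h1 : star (U i) (U i x) = x := congrArg (fun S : H →L[ℂ] H => S x) (hU i).1
    change X (star (U i) (U i x)) = X x
    rw [h1]
  have : FiniteDimensional ℂ (LinearMap.range (Y : H →ₗ[ℂ] H)) := hfin
  have : FiniteDimensional ℂ (H ⧸ LinearMap.ker (Y : H →ₗ[ℂ] H)) :=
    (LinearMap.quotKerEquivRange (Y : H →ₗ[ℂ] H)).symm.finiteDimensional
  exact Submodule.finiteDimensional_of_le hrange

theorem HasTrace.hasSum_one_of_expansion {T : H →L[ℂ] H} (htr : HasTrace T 1) {n : ℕ} {c : ℕ → ℝ}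
    {e : Fin n → H} (hcn : ∀ i, n ≤ i → c i = 0) (he : Orthonormal ℂ e)
    (hexp : ∀ x, T x = ∑ i : Fin n, ((c i : ℂ) * inner ℂ (e i) x) • e i) : HasSum c 1 := by
  have h : HasSum (fun i : Fin n => c i) 1 :=
    HasTrace.hasSum_eigenvalues (c := 1) (by simpa using htr) he
      (apply_eq_smul_of_expansion he hexp) fun x hx => by
      rw [hexp]; simp [hx]
  refine (Fin.val_injective.hasSum_iff fun i hi => hcn i ?_).1 h
  by_contra h'
  exact hi ⟨⟨i, not_le.1 h'⟩, rfl⟩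

theorem tsum_ofReal_of_hasSum {a : ℕ → ℝ} {s : ℝ} (ha0 : ∀ i, 0 ≤ a i) (ha : HasSum a s) :
    ∑' i, ENNReal.ofReal (a i) = ENNReal.ofReal s := by
  rw [← ENNReal.ofReal_tsum_of_nonneg ha0 ha.summable, ha.tsum_eq]

theorem hasSum_of_tsum_ofReal {a : ℕ → ℝ} {s : ℝ} (ha0 : ∀ i, 0 ≤ a i) (hs : 0 ≤ s)
    (h : ∑' i, ENNReal.ofReal (a i) = ENNReal.ofReal s) : HasSum a s := by
  have hsum : Summable a := by
    have := ENNReal.summable_toReal (h.trans_ne ENNReal.ofReal_ne_top)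
    simpa only [ENNReal.toReal_ofReal (ha0 _)] using this
  rw [← ENNReal.ofReal_tsum_of_nonneg ha0 hsum,
    ENNReal.ofReal_eq_ofReal_iff (tsum_nonneg ha0) hs] at h
  exact h ▸ hsum.hasSum

theorem majorizedBy_of_isMixedUnitary {ρ₁ ρ₂ : H →L[ℂ] H} (hρ₁ : IsDensityOperator ρ₁)
    (hρ₂ : IsDensityOperator ρ₂) (hfin : IsFiniteRank ρ₁)
    {Φ : (H →L[ℂ] H) →ₗ[ℂ] (H →L[ℂ] H)} (hΦ : IsMixedUnitary Φ) (h : Φ ρ₂ = ρ₁) :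
    MajorizedBy ρ₁ ρ₂ := by
  obtain ⟨m, t, U, ht, ht1, hU, hΦX⟩ := hΦ
  rw [hΦX] at h
  have hm : Nonempty (Fin m) := by
    by_contra hne
    rw [not_nonempty_iff] at hne
    simp at ht1
  have hfin₂ : IsFiniteRank ρ₂ :=
    isFiniteRank_of_mixedUnitary hρ₂.1 ht hU h.symm hfin (Classical.arbitrary _)
  obtain ⟨n, a, e, ha, ha0, han, he, hexp⟩ := exists_expansion_of_isFiniteRank hρ₁.1 hfin
  obtain ⟨n', b, e', hb, hb0, hbn, he', hexp'⟩ := exists_expansion_of_isFiniteRank hρ₂.1 hfin₂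
  refine ⟨a, b, isEigenvalueSequence_of_expansion ha han he hexp,
    isEigenvalueSequence_of_expansion hb hbn he' hexp', ?_, ?_⟩
  -- Only `n` orthonormal eigenvectors are available; beyond `n` the partial sums of `a` are
  -- constant.
  · have key : ∀ k, k ≤ n → ∑ i ∈ Finset.range k, a i ≤ ∑ i ∈ Finset.range k, b i := by
      intro k hk
      set g : Fin k → H := fun i => e (Fin.castLE hk i) with hg
      have hgo : Orthonormal ℂ g := he.comp _ (Fin.castLE_injective hk)
      have h1 : ∀ i : Fin k, a i = (inner ℂ (g i) (ρ₁ (g i))).re := by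
        intro i
        rw [re_inner_expansion hexp, Finset.sum_eq_single (Fin.castLE hk i)]
        · simp [hg, he.1]
        · intro j _ hj
          rw [hg, he.2 hj]; simp
        · simp
      have h2 : ∀ j, ∑ i, (inner ℂ (star (U j) (g i)) (ρ₂ (star (U j) (g i)))).re ≤
          ∑ i ∈ Finset.range k, b i := by
        intro j
        refine sum_re_inner_le_of_expansion hb hb0 he' hexp' ?_
        let V := (Unitary.linearIsometryEquiv (star ⟨U j, hU j⟩ : unitary (H →L[ℂ] H)))
        exact hgo.comp_linearIsometry V.toLinearIsometry
      calc ∑ i ∈ Finset.range k, a i = ∑ i : Fin k, (inner ℂ (g i) (ρ₁ (g i))).re := by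
            rw [← Fin.sum_univ_eq_sum_range]
            exact Finset.sum_congr rfl fun i _ => h1 i
        _ = ∑ j, t j * ∑ i, (inner ℂ (star (U j) (g i)) (ρ₂ (star (U j) (g i)))).re := by
            simp only [← h, re_inner_mixedUnitary, Finset.mul_sum]
            exact Finset.sum_comm
        _ ≤ ∑ j, t j * ∑ i ∈ Finset.range k, b i :=
            Finset.sum_le_sum fun j _ => mul_le_mul_of_nonneg_left (h2 j) (ht j).le
        _ = ∑ i ∈ Finset.range k, b i := by rw [← Finset.sum_mul, ht1, one_mul]
    intro k
    rcases le_total k n with hk | hk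
    · exact key k hk
    · have h1 : ∑ i ∈ Finset.range n, a i = ∑ i ∈ Finset.range k, a i :=
        Finset.sum_subset (Finset.range_mono hk) fun i _ hi => han i (by simpa using hi)
      rw [← h1]
      exact (key n le_rfl).trans
        (Finset.sum_le_sum_of_subset_of_nonneg (Finset.range_mono hk) fun i _ _ => hb0 i)
  · rw [tsum_ofReal_of_hasSum ha0 (hρ₁.2.hasSum_one_of_expansion han he hexp),
      tsum_ofReal_of_hasSum hb0 (hρ₂.2.hasSum_one_of_expansion hbn he' hexp')]

/-- A sum of rank-one operators along a basis, conjugated by a unitary operator. -/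
theorem unitary_conj_expansion {ι : Type*} [Fintype ι] {T U : H →L[ℂ] H} {c : ι → ℝ}
    {f g : ι → H} (hexp : ∀ x, T x = ∑ i, ((c i : ℂ) * inner ℂ (f i) x) • f i)
    (hUf : ∀ i, U (f i) = g i) (x : H) :
    (U * T * star U) x = ∑ i, ((c i : ℂ) * inner ℂ (g i) x) • g i := by
  change U (T (star U x)) = _
  rw [hexp, map_sum]
  refine Finset.sum_congr rfl fun i _ => ?_
  rw [map_smul, hUf, inner_star_apply_of_unitary, hUf]

theorem exists_mixedUnitary_of_majorizedBy {ρ₁ ρ₂ : H →L[ℂ] H} (hρ₁ : IsDensityOperator ρ₁)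
    (hρ₂ : IsDensityOperator ρ₂) (hfin : IsFiniteRank ρ₁) (h : MajorizedBy ρ₁ ρ₂) :
    ∃ Φ : (H →L[ℂ] H) →ₗ[ℂ] (H →L[ℂ] H), IsMixedUnitary Φ ∧ Φ ρ₂ = ρ₁ := by
  obtain ⟨a, b, ha, hb, hmaj, htot⟩ := h
  have ha0 := ha.1.nonneg
  have hb0 := hb.1.nonneg
  obtain ⟨e, he, hTe, hspan⟩ := ha.exists_orthonormal hρ₁.1
  obtain ⟨e', he', hTe', -⟩ := hb.exists_orthonormal hρ₂.1
  have hker : ∀ x, (∀ n : {n // 0 < a n}, inner ℂ (e n) x = 0) → ρ₁ x = 0 := by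
    intro x hx
    refine apply_eq_zero_of_forall_inner_eq_zero hρ₁.1 hfin hspan ?_
    rintro _ ⟨n, hn, rfl⟩
    exact hx ⟨n, hn⟩
  have hsupp : ∀ c : ℕ → ℝ, (∀ i, 0 ≤ c i) → ∀ i ∉ Set.range (Subtype.val : {n // 0 < c n} → ℕ),
      c i = 0 := by
    intro c hc0 i hi
    by_contra hne
    exact hi ⟨⟨i, (hc0 i).lt_of_ne' hne⟩, rfl⟩
  have hasum : HasSum a 1 := by
    have h1 : HasSum (fun n : {n // 0 < a n} => a n) 1 :=
      HasTrace.hasSum_eigenvalues (c := 1) (by simpa using hρ₁.2) he (fun n => hTe n n.2) hker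
    exact (Subtype.val_injective.hasSum_iff (hsupp a ha0)).1 h1
  have hbsum : HasSum b 1 :=
    hasSum_of_tsum_ofReal hb0 zero_le_one (by rw [← htot, tsum_ofReal_of_hasSum ha0 hasum])
  -- Finite rank of `ρ₂` is not yet known, so its kernel is found through the trace instead.
  have hker' : ∀ x, (∀ n : {n // 0 < b n}, inner ℂ (e' n) x = 0) → ρ₂ x = 0 := by
    intro x hx
    exact HasTrace.apply_eq_zero_of_hasSum (c := 1) hρ₂.1 (by simpa using hρ₂.2) he'
      (fun n => hTe' n n.2) ((Subtype.val_injective.hasSum_iff (hsupp b hb0)).2 hbsum) hx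
  obtain ⟨N, haN⟩ : ∃ N, ∀ n, N ≤ n → a n = 0 := by
    have : FiniteDimensional ℂ (LinearMap.range (ρ₁ : H →ₗ[ℂ] H)) := hfin
    refine ⟨_, (exists_orthonormalBasis_expansion ha.1.1 ha0 he hTe hker
      (LinearMap.range (ρ₁ : H →ₗ[ℂ] H)) fun n hn => ?_).1⟩
    refine ⟨((a n : ℂ)⁻¹) • e n, ?_⟩
    have hne : (a n : ℂ) ≠ 0 := by exact_mod_cast hn.ne'
    change ρ₁ _ = _
    rw [map_smul, hTe n hn, smul_smul, inv_mul_cancel₀ hne, one_smul]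
  have hbN : ∀ n, N ≤ n → b n = 0 := by
    intro n hn
    have h1 : ∑ i ∈ Finset.range N, a i = 1 :=
      (hasSum_sum_of_ne_finset_zero fun i hi => haN i (by simpa using hi)).unique hasum
    have h2 := sum_le_hasSum (insert n (Finset.range N)) (fun i _ => hb0 i) hbsum
    rw [Finset.sum_insert (by simpa using hn)] at h2
    linarith [hmaj N, hb0 n]
  set K : Submodule ℂ H := Submodule.span ℂ (e '' Set.Iio N ∪ e' '' Set.Iio N) with hK
  have hKfin : FiniteDimensional ℂ K := FiniteDimensional.span_of_finite ℂ
    (((Set.finite_Iio N).image e).union ((Set.finite_Iio N).image e'))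
  have hpos : ∀ c : ℕ → ℝ, (∀ n, N ≤ n → c n = 0) → ∀ n, 0 < c n → n ∈ Set.Iio N := by
    intro c hc n hn
    by_contra hne
    rw [hc n (by simpa using hne)] at hn
    exact hn.false
  obtain ⟨haD, f, hf⟩ := exists_orthonormalBasis_expansion ha.1.1 ha0 he hTe hker K
    fun n hn => Submodule.subset_span (Or.inl ⟨n, hpos a haN n hn, rfl⟩)
  obtain ⟨hbD, f', hf'⟩ := exists_orthonormalBasis_expansion hb.1.1 hb0 he' hTe' hker' K
    fun n hn => Submodule.subset_span (Or.inr ⟨n, hpos b hbN n hn, rfl⟩)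
  have hD : ∑ i ∈ Finset.range (Module.finrank ℂ K), a i =
      ∑ i ∈ Finset.range (Module.finrank ℂ K), b i :=
    ((hasSum_sum_of_ne_finset_zero fun i hi => haD i (by simpa using hi)).unique hasum).trans
      ((hasSum_sum_of_ne_finset_zero fun i hi => hbD i (by simpa using hi)).unique hbsum).symm
  obtain ⟨ι, _, z, w, hz, -, hw, hw1, hwz⟩ :=
    eq_pos_convex_span_of_mem_convexHull (mem_convexHull_range_perm ha.1.1 hmaj hD)
  choose σ hσ using fun i => hz (Set.mem_range_self i)
  -- `reindex (σ i)` uses the inverse of `σ i`: the unitary sends `f' (σ i j)` to `f j`, so the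
  -- conjugate of `ρ₂` has eigenvalue `b (σ i j)` at `f j`.
  choose U hU hUf using fun i => exists_unitary_apply_eq (f.reindex (σ i)) f'
  have hconj : ∀ k x, (U k * ρ₂ * star (U k)) x =
      ∑ i : Fin (Module.finrank ℂ K), ((z k i : ℂ) * inner ℂ (f i : H) x) • (f i : H) := by
    intro k x
    rw [unitary_conj_expansion hf' (hUf k), ← Equiv.sum_comp (σ k)]
    refine Finset.sum_congr rfl fun i _ => ?_
    simp [← hσ k]
  have hsum : ∑ k, (w k : ℂ) • (U k * ρ₂ * star (U k)) = ρ₁ := by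
    ext x
    rw [sum_apply, hf]
    simp only [smul_apply, hconj, Finset.smul_sum, smul_smul, ← mul_assoc]
    rw [Finset.sum_comm]
    refine Finset.sum_congr rfl fun i _ => ?_
    rw [← Finset.sum_smul, ← Finset.sum_mul]
    congr 2
    have := congrFun hwz i
    simp only [Finset.sum_apply, Pi.smul_apply, smul_eq_mul] at this
    rw [← this]
    push_cast
    rfl
  let ψ := (Fintype.equivFin ι).symm
  refine ⟨∑ k, (w k : ℂ) • ((LinearMap.mulLeft ℂ (U k)).comp
    (LinearMap.mulRight ℂ (star (U k)))), ⟨Fintype.card ι, w ∘ ψ, U ∘ ψ, fun i => hw _, ?_,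
    fun i => hU _, fun X => ?_⟩, ?_⟩
  · rw [← hw1]
    exact Equiv.sum_comp ψ w
  · simp only [Function.comp_apply]
    rw [Equiv.sum_comp ψ (fun k => (w k : ℂ) • (U k * X * star (U k))), LinearMap.sum_apply]
    exact Finset.sum_congr rfl fun k _ => by simp [mul_assoc]
  · rw [← hsum, LinearMap.sum_apply]
    exact Finset.sum_congr rfl fun k _ => by simp [mul_assoc]

end MixedUnitary

end QuantumMajorization

theorem proposition3p2 {H : Type*} [NormedAddCommGroup H] [InnerProductSpace ℂ H]
    [CompleteSpace H] [TopologicalSpace.SeparableSpace H]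
    (ρ₁ ρ₂ : H →L[ℂ] H)
    (hρ₁ : QuantumMajorization.IsDensityOperator ρ₁)
    (hρ₂ : QuantumMajorization.IsDensityOperator ρ₂)
    (hfin : QuantumMajorization.IsFiniteRank ρ₁) :
    QuantumMajorization.MajorizedBy ρ₁ ρ₂ ↔
      ∃ Φ : (H →L[ℂ] H) →ₗ[ℂ] (H →L[ℂ] H),
        QuantumMajorization.IsMixedUnitary Φ ∧ Φ ρ₂ = ρ₁ :=
  ⟨QuantumMajorization.exists_mixedUnitary_of_majorizedBy hρ₁ hρ₂ hfin,
    fun ⟨_, hΦ, h⟩ => QuantumMajorization.majorizedBy_of_isMixedUnitary hρ₁ hρ₂ hfin hΦ h⟩
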